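/- Let $f:[0,1]\to[0,1]$ be Borel measurable, and let $(X_1,Y_1),(X_2,Y_2),\dots$ be, under a probability measure $P_f$, i.i.d. pairs such that $X_i$ is uniform on $[0,1]$ and, given $X_i=x$, $Y_i\in\{0,1\}$ is Bernoulli with success probability $f(x)$. Write $(\mathbf X,\mathbf Y)_n$ for the first $n$ pairs. For $m\ge 0$ and a vector $\mathbf u\in[0,1]^m$ of (not necessarily ordered) split points, let $J_0(\mathbf u),\dots,J_m(\mathbf u)$ be the intervals, numbered from left to right, into which $\mathbf u$ divides $[0,1]$, and for $\mathbf w\in[0,1]^{m+1}$ let $g_{\mathbf u,\mathbf w}$ be the step function equal to $w_i$ on $J_i(\mathbf u)$. For a data set $d=(x_j,y_j)_{1\le j\le n}$ let $N_i^S$ and $N_i^F$ be the numbers of $j$ with $x_j\in J_i(\mathbf u)$ and $y_j=1$, respectively $y_j=0$, and put $$L(\mathbf u,\mathbf w;d)=\prod_{i=0}^m w_i^{N_i^S}(1-w_i)^{N_i^F},\qquad Z_{\mathbf u}(d)=\int_{[0,1]^{m+1}}L(\mathbf u,\mathbf w;d)\,d\mathbf w,\qquad Z_m(d)=\int_{[0,1]^m}Z_{\mathbf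 u}(d)\,d\mathbf u .$$ Let $Q_{\mathbf u}(\cdot\mid d)$ be the law of $g_{\mathbf u,\mathbf w}$ when $\mathbf w$ has density $L(\mathbf u,\mathbf w;d)/Z_{\mathbf u}(d)$ on $[0,1]^{m+1}$, and let $$Q_m(\cdot\mid d)=\frac{1}{Z_m(d)}\int_{[0,1]^m}Q_{\mathbf u}(\cdot\mid d)\,Z_{\mathbf u}(d)\,d\mathbf u$$ be the posterior distribution for the prior with $m$ independent uniform split points and $m+1$ independent uniform heights. Finally let $H(f)=\int_0^1\bigl(-f\log f-(1-f)\log(1-f)\bigr)\,dx$, with $0\log 0=0$, and $\|g\|_1=\int_0^1|g|\,dx$. (a) If $f$ is almost everywhere equal to a step function with at most $k$ discontinuities in $(0,1)$ (in particular, if $f$ is a step function with exactly $k$ of them), then for each $m\ge k$ and each $\varepsilon>0$, with $P_f$-probability tending to $1$ as $n\to\infty$, both $$Q_m\bigl(\{g:\|g-f\|_1\ge\varepsilon\}\,\big|\,(\mathbf X,\mathbf Y)_n\bigr)<\varepsilon\qquad\text{and}\qquad \Bigl|\tfrac1n\log Z_m\bigl((\mathbf X,\mathbf Y)_n\bigr)+H(f)\Bigr|<\varepsilon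 .$$ (b) Let $K\ge 0$ be an integer. If $f$ is not almost everywhere equal to a step function with at most $K$ discontinuities in $(0,1)$, then there exists $\varepsilon>0$ such that, with $P_f$-probability tending to $1$ as $n\to\infty$, $$\max_{0\le m\le K}Z_m\bigl((\mathbf X,\mathbf Y)_n\bigr)<\exp\{-nH(f)-n\varepsilon\}.$$ -/

import Mathlib

open MeasureTheory ProbabilityTheory Filter Topology unitInterval

noncomputable section

namespace BinReg

/-- Joint law on `[0,1] × {failure, success}` of a pair `(X, Y)` such that `X` is uniform on `[0,1]`
and, given `X = x`, `Y` is Bernoulli with success probability `f x`: the density with respect to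
Lebesgue measure times counting measure is `f x` at `(x, true)` and `1 - f x` at `(x, false)`. -/
def pairLaw (f : I → I) : Measure (I × Bool) :=
  ((volume : Measure I).prod Measure.count).withDensity
    fun p => ENNReal.ofReal (if p.2 then (f p.1 : ℝ) else 1 - (f p.1 : ℝ))

/-- Under `P`, the pairs `(X j, Y j)`, `j = 0, 1, 2, …`, are i.i.d. with law `pairLaw f`. -/
structure IsDataStream {Ω : Type*} [MeasurableSpace Ω] (P : Measure Ω) (f : I → I)
    (X : ℕ → Ω → I) (Y : ℕ → Ω → Bool) : Prop where
  measurable_X : ∀ j, Measurable (X j)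
  measurable_Y : ∀ j, Measurable (Y j)
  indep : iIndepFun (fun (j : ℕ) (ω : Ω) => (X j ω, Y j ω)) P
  law : ∀ j, P.map (fun ω => (X j ω, Y j ω)) = pairLaw f

/-- The first `n` observations of a data stream. -/
def sample {Ω : Type*} (X : ℕ → Ω → I) (Y : ℕ → Ω → Bool) (n : ℕ) (ω : Ω) : Fin n → I × Bool :=
  fun j => (X j ω, Y j ω)

/-- Index of the cell containing `x` in the partition of `[0,1]` by the (not necessarily ordered)
split points `u`; the cells are numbered from left to right. -/
def cell {m : ℕ} (u : Fin m → I) (x : I) : Fin (m + 1) :=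
  ⟨(Finset.univ.filter fun i => u i < x).card,
    Nat.lt_succ_of_le ((Finset.card_filter_le _ _).trans_eq (by simp))⟩

/-- The step function with split points `u` whose height on the `i`-th cell is `w i`. -/
def stepFun {m : ℕ} (u : Fin m → I) (w : Fin (m + 1) → I) : I → I :=
  fun x => w (cell u x)

/-- `f` is, up to a Lebesgue null set, a step function all of whose discontinuities are among
`k` points of `(0,1)` (so it has at most `k` of them). -/
def IsStepFunction (k : ℕ) (f : I → I) : Prop :=
  ∃ (u : Fin k → I) (w : Fin (k + 1) → I),
    (∀ i, u i ∈ Set.Ioo (0 : I) 1) ∧ f =ᵐ[volume] stepFun u w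

/-- Number of successes in the `i`-th cell. -/
def numSucc {m n : ℕ} (u : Fin m → I) (d : Fin n → I × Bool) (i : Fin (m + 1)) : ℕ :=
  (Finset.univ.filter fun j => cell u (d j).1 = i ∧ (d j).2 = true).card

/-- Number of failures in the `i`-th cell. -/
def numFail {m n : ℕ} (u : Fin m → I) (d : Fin n → I × Bool) (i : Fin (m + 1)) : ℕ :=
  (Finset.univ.filter fun j => cell u (d j).1 = i ∧ (d j).2 = false).card

/-- Likelihood of the data under the step function with split points `u` and heights `w`. -/
def likelihood {m n : ℕ} (u : Fin m → I) (w : Fin (m + 1) → I) (d : Fin n → I × Bool) : ℝ :=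
  ∏ i, (w i : ℝ) ^ numSucc u d i * (1 - (w i : ℝ)) ^ numFail u d i

/-- The predictive probability `Z_u` of the data, for fixed split points `u` and
independent uniform heights. -/
def Zsplit {m n : ℕ} (u : Fin m → I) (d : Fin n → I × Bool) : ℝ :=
  ∫ w : Fin (m + 1) → I, likelihood u w d

/-- The predictive probability `Z_m` of the data, for `m` independent uniform split points. -/
def Z (m : ℕ) {n : ℕ} (d : Fin n → I × Bool) : ℝ :=
  ∫ u : Fin m → I, Zsplit u d

/-- The posterior distribution of the heights, for fixed split points `u`. -/
def heightPosterior {m n : ℕ} (u : Fin m → I) (d : Fin n → I × Bool) :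
    Measure (Fin (m + 1) → I) :=
  (volume : Measure (Fin (m + 1) → I)).withDensity
    fun w => ENNReal.ofReal ((Zsplit u d)⁻¹ * likelihood u w d)

/-- The posterior probability `Q_m(A | d)` of a set `A` of regression functions: the mixture of the
posteriors for fixed split points `u`, with weights proportional to `Z_u`. -/
def posterior (m : ℕ) {n : ℕ} (d : Fin n → I × Bool) (A : Set (I → I)) : ENNReal :=
  (∫⁻ u : Fin m → I, heightPosterior u d {w | stepFun u w ∈ A} * ENNReal.ofReal (Zsplit u d)) /
    ENNReal.ofReal (Z m d)

/-- The `L¹` distance of two regression functions. -/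
def l1dist (g f : I → I) : ℝ := ∫ x : I, |(g x : ℝ) - (f x : ℝ)|

/-- The entropy functional; `Real.binEntropy` is the Shannon entropy in nats. -/
def entropy (f : I → I) : ℝ := ∫ x : I, Real.binEntropy (f x)

end BinReg

end

noncomputable section

namespace BinReg

/-! By the law of large numbers, `1/n` times the log-likelihood of a step function `g` should tend
to `-H(f)` minus a Kullback–Leibler divergence, which dominates `‖f - g‖₂² / 9`. Two obstacles
remain: the logarithm is unbounded at heights 0 and 1, and the bounds must hold for all parameters
at once. Both are met by envelopes: on a small ball of parameters the likelihood is squeezed between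
products of i.i.d. factors bounded away from 0 and ∞, so one use of the strong law serves the whole
ball.

From above (`meanLog_upperEnv_le`), compactness of the parameter cube leaves finitely many balls.
This gives `eventually_likelihood_le` when a lower bound on the `L²` distance is known, and
`exists_eventually_likelihood_le` when `f` is no step function of the given size. From below
(`eventually_le_Z`), if `f` is such a step function, a ball of fixed positive volume has likelihood
at least `exp(-n(H(f) + δ/2))`.

Since `Z` is at most the supremum of the likelihood, (b) follows from the upper bound alone. For
(a), the posterior mass of a set is at most the supremum of the likelihood over it divided by `Z`,
and this ratio decays exponentially. -/

/-- Probability of the outcome `b` under the Bernoulli law with success probability `p`. -/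
def bern (p : ℝ) (b : Bool) : ℝ := if b then p else 1 - p

lemma bern_nonneg (p : I) (b : Bool) : 0 ≤ bern p b := by
  have h0 := p.2.1
  have h1 := p.2.2
  unfold bern
  split_ifs <;> linarith

lemma bern_le_one (p : I) (b : Bool) : bern p b ≤ 1 := by
  have h0 := p.2.1
  have h1 := p.2.2
  unfold bern
  split_ifs <;> linarith

lemma measurable_bern_comp {g : I → I} (hg : Measurable g) :
    Measurable fun p : I × Bool => bern (g p.1) p.2 := by
  have h : Measurable fun p : I × Bool => ((g p.1 : I) : ℝ) := by fun_prop
  exact Measurable.ite (measurable_snd (measurableSet_singleton true)) h (h.const_sub 1)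

/-! ### Step functions -/

lemma measurable_stepFun_joint {m : ℕ} (x : I) :
    Measurable fun θ : (Fin m → I) × (Fin (m + 1) → I) => stepFun θ.1 θ.2 x := by
  have hc : Measurable fun θ : (Fin m → I) × (Fin (m + 1) → I) => cell θ.1 x := by
    refine measurable_to_countable' fun c => ?_
    have h : Measurable fun θ : (Fin m → I) × (Fin (m + 1) → I) =>
        ∑ i : Fin m, if θ.1 i < x then 1 else 0 := by
      refine Finset.measurable_sum _ fun i _ => Measurable.ite ?_ measurable_const measurable_const
      exact measurableSet_lt (by fun_prop) measurable_const
    convert h (measurableSet_singleton (c : ℕ)) using 1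
    ext θ
    simp [cell, Fin.ext_iff]
  have h : ∀ c : Fin (m + 1), Measurable fun θ : (Fin m → I) × (Fin (m + 1) → I) => θ.2 c :=
    fun c => by fun_prop
  exact (measurable_from_prod_countable_right (f := fun p : Fin (m + 1) × _ => p.2.2 p.1) h).comp
    (hc.prodMk measurable_id)

lemma measurable_cell {m : ℕ} (u : Fin m → I) : Measurable (cell u) := by
  refine measurable_to_countable' fun c => ?_
  have h : Measurable fun x : I => ∑ i : Fin m, if u i < x then 1 else 0 := by
    refine Finset.measurable_sum _ fun i _ => Measurable.ite ?_ measurable_const measurable_const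
    exact measurableSet_lt measurable_const measurable_id
  convert h (measurableSet_singleton (c : ℕ)) using 1
  ext x
  simp [cell, Fin.ext_iff]

lemma measurable_stepFun {m : ℕ} (u : Fin m → I) (w : Fin (m + 1) → I) :
    Measurable (stepFun u w) :=
  (measurable_of_finite w).comp (measurable_cell u)

/-- The set of split points below `x` grows with `x`, so equal cardinalities force equal sets. -/
lemma cell_eq_iff {m : ℕ} {u : Fin m → I} {x y : I} (hxy : x ≤ y) :
    cell u x = cell u y ↔ ∀ i, u i < y → u i < x := by
  have hsub : (Finset.univ.filter fun i => u i < x) ⊆ Finset.univ.filter fun i => u i < y := by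
    intro i
    simpa using fun h => lt_of_lt_of_le h hxy
  rw [cell, cell, Fin.mk.injEq]
  constructor
  · intro h i hi
    have := Finset.eq_of_subset_of_card_le hsub h.ge
    have hi' : i ∈ Finset.univ.filter fun i => u i < y := by simpa using hi
    rw [← this] at hi'
    simpa using hi'
  · intro h
    congr 1
    refine Finset.Subset.antisymm hsub fun i => ?_
    simpa using h i

/-- A function which, on `(0,1)`, is constant on the cells of interior split points is almost
everywhere a step function. -/
lemma isStepFunction_of_const_on_cells {K : ℕ} {g : I → I} (u : Fin K → I)
    (hu : ∀ i, u i ∈ Set.Ioo (0 : I) 1)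
    (h : ∀ x ∈ Set.Ioo (0 : I) 1, ∀ y ∈ Set.Ioo (0 : I) 1, cell u x = cell u y → g x = g y) :
    IsStepFunction K g := by
  classical
  refine ⟨u, fun c => if hc : ∃ x ∈ Set.Ioo (0 : I) 1, cell u x = c then g hc.choose else 0,
    hu, ?_⟩
  have h0 : ∀ᵐ x : I, x ≠ 0 := Measure.ae_ne _ _
  have h1 : ∀ᵐ x : I, x ≠ 1 := Measure.ae_ne _ _
  filter_upwards [h0, h1] with x hx0 hx1
  have hx : x ∈ Set.Ioo (0 : I) 1 :=
    ⟨unitInterval.pos_iff_ne_zero.2 hx0, unitInterval.lt_one_iff_ne_one.2 hx1⟩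
  have hc : ∃ y ∈ Set.Ioo (0 : I) 1, cell u y = cell u x := ⟨x, hx, rfl⟩
  rw [stepFun, dif_pos hc]
  exact h x hx _ hc.choose_spec.1 hc.choose_spec.2.symm

/-- Missing split points, and those at 0 or 1, are replaced by `1/2`. On `(0,1)` this only refines
the partition, as split points at 0 or 1 separate nothing there. -/
lemma isStepFunction_of_ae_eq {m K : ℕ} (hmK : m ≤ K) {f : I → I} (u : Fin m → I)
    (w : Fin (m + 1) → I) (hf : f =ᵐ[volume] stepFun u w) : IsStepFunction K f := by
  classical
  have half : (⟨1 / 2, by norm_num, by norm_num⟩ : I) ∈ Set.Ioo (0 : I) 1 := by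
    constructor <;> rw [← Subtype.coe_lt_coe] <;> norm_num
  let u' : Fin K → I := fun i =>
    if h : (i : ℕ) < m then
      if u ⟨i, h⟩ ∈ Set.Ioo (0 : I) 1 then u ⟨i, h⟩ else ⟨1 / 2, by norm_num, by norm_num⟩
    else ⟨1 / 2, by norm_num, by norm_num⟩
  have key : ∀ x ∈ Set.Ioo (0 : I) 1, ∀ y ∈ Set.Ioo (0 : I) 1, x ≤ y →
      cell u' x = cell u' y → cell u x = cell u y := by
    intro x hx y hy hxy hc
    rw [cell_eq_iff hxy] at hc ⊢
    intro i hi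
    by_cases h0 : 0 < u i
    · have hi' : u' ⟨i, i.2.trans_le hmK⟩ = u i := by
        simp [u', h0, hi.trans hy.2]
      simpa [hi'] using hc ⟨i, i.2.trans_le hmK⟩ (by rwa [hi'])
    · exact (not_lt.1 h0).trans_lt hx.1
  obtain ⟨v, w', hv, h⟩ := isStepFunction_of_const_on_cells (g := stepFun u w) u'
    (fun i => by dsimp only [u']; split_ifs <;> assumption)
    (fun x hx y hy hc => by
      rcases le_total x y with hxy | hxy
      · rw [stepFun, stepFun, key x hx y hy hxy hc]
      · rw [stepFun, stepFun, key y hy x hx hxy hc.symm])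
  exact ⟨v, w', hv, hf.trans h⟩

/-! ### Neighbourhoods of the split points -/

/-- The points at distance less than `r` from one of the split points `u`. -/
def near {m : ℕ} (u : Fin m → I) (r : ℝ) : Set I := ⋃ i, Metric.ball (u i) r

lemma measurableSet_near {m : ℕ} (u : Fin m → I) (r : ℝ) : MeasurableSet (near u r) :=
  MeasurableSet.iUnion fun _ => measurableSet_ball

lemma measureReal_near_le {m : ℕ} (u : Fin m → I) {r : ℝ} (hr : 0 ≤ r) :
    (volume : Measure I).real (near u r) ≤ 2 * m * r := by
  have h1 : ∀ i, (volume : Measure I).real (Metric.ball (u i) r) ≤ 2 * r := by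
    intro i
    refine ENNReal.toReal_le_of_le_ofReal (by positivity) ?_
    rw [unitInterval.volume_apply, ← Real.volume_ball (u i : ℝ) r]
    refine measure_mono ?_
    rintro _ ⟨x, hx, rfl⟩
    exact hx
  calc (volume : Measure I).real (near u r)
      ≤ ∑ i, (volume : Measure I).real (Metric.ball (u i) r) := measureReal_iUnion_fintype_le _
    _ ≤ ∑ _i : Fin m, 2 * r := Finset.sum_le_sum fun i _ => h1 i
    _ = 2 * m * r := by simp; ring

lemma cell_eq_of_notMem_near {m : ℕ} {u v : Fin m → I} {r : ℝ} (huv : dist v u < r) {x : I}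
    (hx : x ∉ near u r) : cell v x = cell u x := by
  have h : ∀ i, v i < x ↔ u i < x := by
    intro i
    have h1 : |(v i : ℝ) - u i| < r := (dist_le_pi_dist v u i).trans_lt huv
    have h2 : r ≤ |(x : ℝ) - u i| := by
      have := fun h => hx (Set.mem_iUnion.2 ⟨i, h⟩)
      exact not_lt.1 this
    rw [← Subtype.coe_lt_coe, ← Subtype.coe_lt_coe]
    rw [abs_lt] at h1
    rcases le_abs.1 h2 with h3 | h3 <;> constructor <;> intro h4 <;> linarith
  simp [cell, h]

/-! ### The likelihood -/

/-- Regrouping by observation instead of by cell gives the product form to which the law of large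
numbers applies. -/
lemma likelihood_eq_prod {m n : ℕ} (u : Fin m → I) (w : Fin (m + 1) → I) (d : Fin n → I × Bool) :
    likelihood u w d = ∏ j, bern (stepFun u w (d j).1) (d j).2 := by
  have h : ∀ j, bern (stepFun u w (d j).1) (d j).2 =
      ∏ i, ((if cell u (d j).1 = i ∧ (d j).2 = true then (w i : ℝ) else 1) *
        (if cell u (d j).1 = i ∧ (d j).2 = false then 1 - (w i : ℝ) else 1)) := by
    intro j
    rw [Finset.prod_eq_single (cell u (d j).1)]
    · cases hb : (d j).2 <;> simp [bern, stepFun]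
    · intro i _ hi
      simp [hi.symm]
    · simp
  simp_rw [h]
  rw [Finset.prod_comm]
  simp_rw [Finset.prod_mul_distrib]
  simp [likelihood, numSucc, numFail, Finset.prod_ite, Finset.prod_mul_distrib]

lemma likelihood_nonneg {m n : ℕ} (u : Fin m → I) (w : Fin (m + 1) → I) (d : Fin n → I × Bool) :
    0 ≤ likelihood u w d := by
  rw [likelihood_eq_prod]
  exact Finset.prod_nonneg fun j _ => bern_nonneg _ _

lemma likelihood_le_one {m n : ℕ} (u : Fin m → I) (w : Fin (m + 1) → I) (d : Fin n → I × Bool) :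
    likelihood u w d ≤ 1 := by
  rw [likelihood_eq_prod]
  exact Finset.prod_le_one (fun j _ => bern_nonneg _ _) fun j _ => bern_le_one _ _

lemma measurable_likelihood {m n : ℕ} (d : Fin n → I × Bool) :
    Measurable fun θ : (Fin m → I) × (Fin (m + 1) → I) => likelihood θ.1 θ.2 d := by
  simp_rw [likelihood_eq_prod]
  refine Finset.measurable_prod _ fun j _ => ?_
  have h : Measurable fun θ : (Fin m → I) × (Fin (m + 1) → I) =>
      ((stepFun θ.1 θ.2 (d j).1 : I) : ℝ) :=
    measurable_subtype_coe.comp (measurable_stepFun_joint _)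
  cases (d j).2
  · simpa [bern] using h.const_sub 1
  · simpa [bern] using h

lemma integrable_likelihood {m n : ℕ} (d : Fin n → I × Bool) :
    Integrable fun θ : (Fin m → I) × (Fin (m + 1) → I) => likelihood θ.1 θ.2 d := by
  refine Integrable.of_bound (measurable_likelihood d).aestronglyMeasurable 1
    (ae_of_all _ fun θ => ?_)
  rw [Real.norm_of_nonneg (likelihood_nonneg _ _ _)]
  exact likelihood_le_one _ _ _

lemma Z_eq_integral_prod (m : ℕ) {n : ℕ} (d : Fin n → I × Bool) :
    Z m d = ∫ θ : (Fin m → I) × (Fin (m + 1) → I), likelihood θ.1 θ.2 d :=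
  (integral_prod _ (integrable_likelihood d)).symm

lemma Z_le {m n : ℕ} {d : Fin n → I × Bool} {M : ℝ}
    (h : ∀ u : Fin m → I, ∀ w, likelihood u w d ≤ M) : Z m d ≤ M := by
  rw [Z_eq_integral_prod]
  calc _ ≤ ∫ _θ : (Fin m → I) × (Fin (m + 1) → I), M :=
        integral_mono (integrable_likelihood d) (integrable_const M) fun θ => h θ.1 θ.2
    _ = M := by simp

lemma measureReal_mul_le_Z {m n : ℕ} {d : Fin n → I × Bool} {M : ℝ}
    {S : Set ((Fin m → I) × (Fin (m + 1) → I))} (hS : MeasurableSet S)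
    (h : ∀ θ ∈ S, M ≤ likelihood θ.1 θ.2 d) :
    volume.real S * M ≤ Z m d := by
  rw [Z_eq_integral_prod]
  calc volume.real S * M = ∫ _θ in S, M := by simp
    _ ≤ ∫ θ in S, likelihood θ.1 θ.2 d :=
        setIntegral_mono_on integrableOn_const (integrable_likelihood d).integrableOn hS h
    _ ≤ _ := setIntegral_le_integral (integrable_likelihood d)
        (ae_of_all _ fun θ => likelihood_nonneg _ _ _)

/-- The mixture weight `Zsplit` cancels the normalisation of the height posterior, leaving the
likelihood integrated over the parameters in `A`. No measurability of `A` is needed, since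
`withDensity_apply'` covers arbitrary sets. -/
lemma posterior_le {m n : ℕ} {d : Fin n → I × Bool} {A : Set (I → I)} {M : ℝ}
    (h : ∀ u : Fin m → I, ∀ w, stepFun u w ∈ A → likelihood u w d ≤ M) :
    posterior m d A ≤ ENNReal.ofReal M / ENNReal.ofReal (Z m d) := by
  refine ENNReal.div_le_div_right ?_ _
  calc _ ≤ ∫⁻ _u : Fin m → I, ENNReal.ofReal M := lintegral_mono fun u => ?_
    _ = ENNReal.ofReal M := by simp
  rcases le_or_gt (Zsplit u d) 0 with hZ | hZ
  · simp [ENNReal.ofReal_of_nonpos hZ]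
  have h1 : heightPosterior u d {w | stepFun u w ∈ A} ≤ ENNReal.ofReal ((Zsplit u d)⁻¹ * M) := by
    rw [heightPosterior, withDensity_apply']
    calc _ ≤ ∫⁻ _w in {w | stepFun u w ∈ A}, ENNReal.ofReal ((Zsplit u d)⁻¹ * M) := by
          refine setLIntegral_mono measurable_const fun w hw => ?_
          exact ENNReal.ofReal_le_ofReal (mul_le_mul_of_nonneg_left (h u w hw) (inv_pos.2 hZ).le)
      _ ≤ ∫⁻ _w, ENNReal.ofReal ((Zsplit u d)⁻¹ * M) := setLIntegral_le_lintegral _ _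
      _ = _ := by simp
  calc _ ≤ ENNReal.ofReal ((Zsplit u d)⁻¹ * M) * ENNReal.ofReal (Zsplit u d) := by gcongr
    _ = ENNReal.ofReal M := by
      rw [← ENNReal.ofReal_mul' hZ.le]
      congr 1
      field_simp

/-! ### Laws of large numbers -/

lemma integral_pairLaw {f : I → I} (hf : Measurable f) {φ : I × Bool → ℝ} (hφ : Measurable φ)
    {C : ℝ} (hC : ∀ p, |φ p| ≤ C) :
    ∫ p, φ p ∂pairLaw f = ∫ x, (f x * φ (x, true) + (1 - f x) * φ (x, false)) := by
  have hm : Measurable fun p : I × Bool => bern (f p.1) p.2 := measurable_bern_comp hf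
  have h1 : ∫ p, φ p ∂pairLaw f =
      ∫ p : I × Bool, bern (f p.1) p.2 * φ p ∂((volume : Measure I).prod Measure.count) := by
    rw [show pairLaw f = ((volume : Measure I).prod Measure.count).withDensity
      fun p => ENNReal.ofReal (bern (f p.1) p.2) from rfl,
      integral_withDensity_eq_integral_toReal_smul hm.ennreal_ofReal
        (ae_of_all _ fun _ => ENNReal.ofReal_lt_top)]
    refine integral_congr_ae (ae_of_all _ fun p => ?_)
    simp [ENNReal.toReal_ofReal (bern_nonneg _ _)]
  rw [h1, integral_prod]
  · simp [bern]
  · refine Integrable.of_bound (hm.mul hφ).aestronglyMeasurable C (ae_of_all _ fun p => ?_)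
    rw [Real.norm_eq_abs, abs_mul, abs_of_nonneg (bern_nonneg _ _)]
    calc _ ≤ 1 * C := mul_le_mul (bern_le_one _ _) (hC p) (abs_nonneg _) zero_le_one
      _ = C := one_mul C

variable {Ω : Type*} [MeasurableSpace Ω] {P : Measure Ω} [IsProbabilityMeasure P]
  {f : I → I} {X : ℕ → Ω → I} {Y : ℕ → Ω → Bool}

lemma IsDataStream.tendsto_average (hXY : IsDataStream P f X Y) (hf : Measurable f)
    {φ : I × Bool → ℝ} (hφ : Measurable φ) {C : ℝ} (hC : ∀ p, |φ p| ≤ C) :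
    ∀ᵐ ω ∂P, Tendsto (fun n : ℕ => (∑ j ∈ Finset.range n, φ (X j ω, Y j ω)) / n) atTop
      (𝓝 (∫ x, (f x * φ (x, true) + (1 - f x) * φ (x, false)))) := by
  have hm : ∀ j, Measurable fun ω => (X j ω, Y j ω) := fun j =>
    (hXY.measurable_X j).prodMk (hXY.measurable_Y j)
  have h := strong_law_ae_real (μ := P) (fun j ω => φ (X j ω, Y j ω))
    (Integrable.of_bound (hφ.comp (hm 0)).aestronglyMeasurable C (ae_of_all _ fun ω => hC _))
    (fun i j hij => (hXY.indep.indepFun hij).comp hφ hφ)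
    (fun j => IdentDistrib.comp
      ⟨(hm j).aemeasurable, (hm 0).aemeasurable, (hXY.law j).trans (hXY.law 0).symm⟩ hφ)
  have hE : ∫ ω, φ (X 0 ω, Y 0 ω) ∂P = ∫ x, (f x * φ (x, true) + (1 - f x) * φ (x, false)) := by
    rw [← integral_pairLaw hf hφ hC, ← hXY.law 0,
      integral_map (hm 0).aemeasurable hφ.aestronglyMeasurable]
  rwa [hE] at h

/-- Expectation, under `pairLaw f`, of the logarithm of `ψ`. -/
def meanLog (f : I → I) (ψ : I × Bool → ℝ) : ℝ :=
  ∫ x, (f x * Real.log (ψ (x, true)) + (1 - f x) * Real.log (ψ (x, false)))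

lemma abs_log_le {c C t : ℝ} (hc : 0 < c) (h1 : c ≤ t) (h2 : t ≤ C) :
    |Real.log t| ≤ max |Real.log c| |Real.log C| :=
  abs_le_max_abs_abs (Real.log_le_log hc h1) (Real.log_le_log (hc.trans_le h1) h2)

lemma integrable_meanLog (hf : Measurable f) {ψ : I × Bool → ℝ} (hψ : Measurable ψ) {c C : ℝ}
    (hc : 0 < c) (hcψ : ∀ p, c ≤ ψ p) (hψC : ∀ p, ψ p ≤ C) :
    Integrable fun x : I =>
      f x * Real.log (ψ (x, true)) + (1 - f x) * Real.log (ψ (x, false)) := by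
  have h : ∀ b, Integrable fun x : I => bern (f x) b * Real.log (ψ (x, b)) := by
    intro b
    have hm : Measurable fun x : I => bern (f x) b * Real.log (ψ (x, b)) :=
      ((measurable_bern_comp hf).mul hψ.log).comp (measurable_id.prodMk measurable_const)
    refine Integrable.of_bound hm.aestronglyMeasurable (max |Real.log c| |Real.log C|)
      (ae_of_all _ fun x => ?_)
    rw [Real.norm_eq_abs, abs_mul, abs_of_nonneg (bern_nonneg _ _), ← one_mul (max _ _)]
    exact mul_le_mul (bern_le_one _ _) (abs_log_le hc (hcψ _) (hψC _)) (abs_nonneg _) zero_le_one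
  exact (h true).add (h false)

lemma IsDataStream.tendsto_log_prod (hXY : IsDataStream P f X Y) (hf : Measurable f)
    {ψ : I × Bool → ℝ} (hψ : Measurable ψ) {c C : ℝ} (hc : 0 < c) (hcψ : ∀ p, c ≤ ψ p)
    (hψC : ∀ p, ψ p ≤ C) :
    ∀ᵐ ω ∂P, Tendsto (fun n : ℕ => Real.log (∏ j, ψ (sample X Y n ω j)) / n) atTop
      (𝓝 (meanLog f ψ)) := by
  filter_upwards [hXY.tendsto_average hf hψ.log fun p => abs_log_le hc (hcψ p) (hψC p)] with ω hω
  refine hω.congr fun n => ?_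
  rw [Real.log_prod fun j _ => (hc.trans_le (hcψ _)).ne']
  rw [← Fin.sum_univ_eq_sum_range fun j => Real.log (ψ (X j ω, Y j ω))]
  rfl

lemma IsDataStream.eventually_prod_le (hXY : IsDataStream P f X Y) (hf : Measurable f)
    {ψ : I × Bool → ℝ} (hψ : Measurable ψ) {c C : ℝ} (hc : 0 < c) (hcψ : ∀ p, c ≤ ψ p)
    (hψC : ∀ p, ψ p ≤ C) {κ : ℝ} (hκ : meanLog f ψ < κ) :
    ∀ᵐ ω ∂P, ∀ᶠ n : ℕ in atTop, ∏ j, ψ (sample X Y n ω j) ≤ Real.exp (n * κ) := by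
  filter_upwards [hXY.tendsto_log_prod hf hψ hc hcψ hψC] with ω hω
  filter_upwards [hω.eventually_lt_const hκ, eventually_gt_atTop 0] with n hn hn0
  have hn0' : (0 : ℝ) < n := by exact_mod_cast hn0
  rw [← Real.log_le_iff_le_exp (Finset.prod_pos fun j _ => hc.trans_le (hcψ _))]
  rw [div_lt_iff₀ hn0'] at hn
  linarith

lemma IsDataStream.eventually_le_prod (hXY : IsDataStream P f X Y) (hf : Measurable f)
    {ψ : I × Bool → ℝ} (hψ : Measurable ψ) {c C : ℝ} (hc : 0 < c) (hcψ : ∀ p, c ≤ ψ p)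
    (hψC : ∀ p, ψ p ≤ C) {κ : ℝ} (hκ : κ < meanLog f ψ) :
    ∀ᵐ ω ∂P, ∀ᶠ n : ℕ in atTop, Real.exp (n * κ) ≤ ∏ j, ψ (sample X Y n ω j) := by
  filter_upwards [hXY.tendsto_log_prod hf hψ hc hcψ hψC] with ω hω
  filter_upwards [hω.eventually_const_lt hκ, eventually_gt_atTop 0] with n hn hn0
  have hn0' : (0 : ℝ) < n := by exact_mod_cast hn0
  rw [← Real.le_log_iff_exp_le (Finset.prod_pos fun j _ => hc.trans_le (hcψ _))]
  rw [lt_div_iff₀ hn0'] at hn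
  linarith

/-! ### Entropy inequalities -/

/-- From `log t ≤ 2(√t - 1)` at `t = q/a`, the left side is at most `q - a - (√a - √q)²`. The
Hellinger term controls `(a - q)²` because `(√a + √q)² ≤ (1 + 2)² = 9`. -/
lemma mul_log_sub_mul_log_le {a q : ℝ} (ha : 0 ≤ a) (ha1 : a ≤ 1) (hq : 0 < q) (hq2 : q ≤ 2) :
    a * Real.log q + a * Real.log a⁻¹ ≤ q - a - (a - q) ^ 2 / 9 := by
  rcases ha.eq_or_lt with rfl | ha
  · simp only [zero_mul, zero_sub]
    nlinarith
  have hs : 0 < √a := Real.sqrt_pos.2 ha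
  have ht : 0 < √q := Real.sqrt_pos.2 hq
  have hs2 : √a ^ 2 = a := Real.sq_sqrt ha.le
  have ht2 : √q ^ 2 = q := Real.sq_sqrt hq.le
  have hs1 : √a ≤ 1 := by nlinarith
  have ht1 : √q ≤ 2 := by nlinarith
  have hlog : Real.log q + Real.log a⁻¹ ≤ 2 * (√q / √a - 1) := by
    have h := Real.log_le_sub_one_of_pos (div_pos ht hs)
    rw [Real.log_div ht.ne' hs.ne', Real.log_sqrt hq.le, Real.log_sqrt ha.le] at h
    rw [Real.log_inv]
    linarith
  have h1 : a * (√q / √a) = √a * √q := by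
    field_simp
    rw [hs2]
  have h2 : a * Real.log q + a * Real.log a⁻¹ ≤ 2 * (√a * √q) - 2 * a := by
    rw [← mul_add]
    calc _ ≤ a * (2 * (√q / √a - 1)) := mul_le_mul_of_nonneg_left hlog ha.le
      _ = _ := by rw [← h1]; ring
  have h3 : (a - q) ^ 2 ≤ 9 * (√a - √q) ^ 2 := by
    have h4 : a - q = (√a - √q) * (√a + √q) := by
      nth_rewrite 1 [← hs2]
      nth_rewrite 1 [← ht2]
      ring
    rw [h4, mul_pow, mul_comm]
    have : (√a + √q) ^ 2 ≤ 9 := by nlinarith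
    exact mul_le_mul_of_nonneg_right this (sq_nonneg _)
  nlinarith

/-- The preceding inequality is summed over both outcomes: the perturbed weights have total mass `1
+ 2r`, and the squares sum to `2(p - g)² + 2r²`. -/
lemma mul_log_add_binEntropy_le {p g r : ℝ} (hp : p ∈ Set.Icc (0 : ℝ) 1)
    (hg : g ∈ Set.Icc (0 : ℝ) 1) (hr : 0 < r) (hr1 : r ≤ 1) :
    p * Real.log (g + r) + (1 - p) * Real.log (1 - g + r) + Real.binEntropy p
      ≤ 2 * r - (p - g) ^ 2 / 9 := by
  obtain ⟨hp0, hp1⟩ := hp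
  obtain ⟨hg0, hg1⟩ := hg
  have h1 := mul_log_sub_mul_log_le hp0 hp1 (q := g + r) (by linarith) (by linarith)
  have h2 := mul_log_sub_mul_log_le (a := 1 - p) (q := 1 - g + r)
    (by linarith) (by linarith) (by linarith) (by linarith)
  rw [Real.binEntropy]
  nlinarith [sq_nonneg (p - g), sq_nonneg r]

/-- Dropping `r / 2` inside each logarithm splits off `log (1 - 2r)`; the rest cancels against the
entropy. -/
lemma le_mul_log_add_binEntropy {p r : ℝ} (hp : p ∈ Set.Icc (0 : ℝ) 1) (hr : 0 < r)
    (hr1 : r < 1 / 2) :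
    Real.log (1 - 2 * r) ≤ p * Real.log ((1 - 2 * r) * p + r / 2)
      + (1 - p) * Real.log ((1 - 2 * r) * (1 - p) + r / 2) + Real.binEntropy p := by
  have key : ∀ a : ℝ, 0 ≤ a →
      a * Real.log (1 - 2 * r) ≤ a * Real.log ((1 - 2 * r) * a + r / 2) + a * Real.log a⁻¹ := by
    intro a ha
    rcases ha.eq_or_lt with rfl | ha
    · simp
    have h2 : 0 < (1 - 2 * r) * a := mul_pos (by linarith) ha
    have h := Real.log_le_log h2 (show (1 - 2 * r) * a ≤ (1 - 2 * r) * a + r / 2 by linarith)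
    rw [Real.log_mul (by linarith) ha.ne'] at h
    rw [← mul_add, Real.log_inv]
    exact mul_le_mul_of_nonneg_left (by linarith) ha.le
  have h1 := key p hp.1
  have h2 := key (1 - p) (by linarith [hp.2])
  rw [Real.binEntropy]
  linarith

lemma integrable_of_measurable_of_bound {h : I → ℝ} (hm : Measurable h) {C : ℝ}
    (hC : ∀ x, |h x| ≤ C) : Integrable h :=
  Integrable.of_bound hm.aestronglyMeasurable C (ae_of_all _ hC)

lemma binEntropy_mem (p : I) : Real.binEntropy p ∈ Set.Icc (0 : ℝ) 1 :=
  ⟨Real.binEntropy_nonneg p.2.1 p.2.2, Real.binEntropy_le_log_two.trans (by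
    have := Real.log_two_lt_d9
    linarith)⟩

lemma integrable_binEntropy (hf : Measurable f) :
    Integrable fun x : I => Real.binEntropy (f x) := by
  refine integrable_of_measurable_of_bound (C := 1) ?_ fun x => ?_
  · exact Real.binEntropy_continuous.measurable.comp (measurable_subtype_coe.comp hf)
  · rw [abs_of_nonneg (binEntropy_mem _).1]
    exact (binEntropy_mem _).2

lemma integrable_sq_sub {g : I → I} (hf : Measurable f) (hg : Measurable g) :
    Integrable fun x : I => ((f x : ℝ) - g x) ^ 2 := by
  refine integrable_of_measurable_of_bound (C := 1) (by fun_prop) fun x => ?_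
  rw [abs_of_nonneg (sq_nonneg _)]
  have h1 := (f x).2
  have h2 := (g x).2
  rw [sq_le_one_iff_abs_le_one, abs_le]
  constructor <;> linarith [h1.1, h1.2, h2.1, h2.2]

/-! ### Upper bounds for the likelihood -/

open Classical in
/-- An upper bound for the likelihood of one observation under all step functions whose parameters
are `r`-close to `(u, w)`. -/
def upperEnv {m : ℕ} (u : Fin m → I) (w : Fin (m + 1) → I) (r : ℝ) (p : I × Bool) : ℝ :=
  if p.1 ∈ near u r then 1 else bern (stepFun u w p.1) p.2 + r

lemma measurable_upperEnv {m : ℕ} (u : Fin m → I) (w : Fin (m + 1) → I) (r : ℝ) :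
    Measurable (upperEnv u w r) :=
  Measurable.ite (measurable_fst (measurableSet_near u r)) measurable_const
    ((measurable_bern_comp (measurable_stepFun u w)).add_const r)

lemma abs_bern_sub (p q : ℝ) (b : Bool) : |bern p b - bern q b| = |p - q| := by
  cases b
  · simp only [bern, Bool.false_eq_true, if_false]
    rw [abs_sub_comm p q]
    congr 1
    ring
  · simp [bern]

lemma abs_bern_stepFun_sub_lt {m : ℕ} {u v : Fin m → I} {w z : Fin (m + 1) → I} {r s : ℝ}
    (huv : dist v u < s) (hwz : dist z w < r) {x : I} (hx : x ∉ near u s) (b : Bool) :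
    |bern (stepFun v z x) b - bern (stepFun u w x) b| < r := by
  rw [abs_bern_sub, stepFun, stepFun, cell_eq_of_notMem_near huv hx]
  exact (dist_le_pi_dist z w _).trans_lt hwz

lemma bern_le_upperEnv {m : ℕ} {u v : Fin m → I} {w z : Fin (m + 1) → I} {r : ℝ}
    (huv : dist v u < r) (hwz : dist z w < r) (p : I × Bool) :
    bern (stepFun v z p.1) p.2 ≤ upperEnv u w r p := by
  unfold upperEnv
  split_ifs with h
  · exact bern_le_one _ _
  · linarith [(abs_lt.1 (abs_bern_stepFun_sub_lt huv hwz h p.2)).2]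

lemma le_upperEnv {m : ℕ} (u : Fin m → I) (w : Fin (m + 1) → I) {r : ℝ} (hr1 : r ≤ 1)
    (p : I × Bool) : r ≤ upperEnv u w r p := by
  unfold upperEnv
  split_ifs
  · exact hr1
  · linarith [bern_nonneg (stepFun u w p.1) p.2]

lemma upperEnv_le {m : ℕ} (u : Fin m → I) (w : Fin (m + 1) → I) {r : ℝ} (hr1 : r ≤ 1)
    (p : I × Bool) : upperEnv u w r p ≤ 2 := by
  unfold upperEnv
  split_ifs
  · norm_num
  · linarith [bern_le_one (stepFun u w p.1) p.2]

/-- Near the split points the envelope is 1 and its logarithm 0; the constant 2 there absorbs both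
the entropy and the square. That set has measure at most `2mr`, whence the term `4mr`. -/
lemma meanLog_upperEnv_le (hf : Measurable f) {m : ℕ} (u : Fin m → I) (w : Fin (m + 1) → I)
    {r : ℝ} (hr : 0 < r) (hr1 : r ≤ 1) :
    meanLog f (upperEnv u w r) ≤
      -entropy f + ((2 + 4 * m) * r - (∫ x, ((f x : ℝ) - stepFun u w x) ^ 2) / 9) := by
  have hpt : ∀ x : I, f x * Real.log (upperEnv u w r (x, true))
        + (1 - f x) * Real.log (upperEnv u w r (x, false)) ≤
      2 * r + (near u r).indicator (fun _ => (2 : ℝ)) x - Real.binEntropy (f x)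
        - ((f x : ℝ) - stepFun u w x) ^ 2 / 9 := by
    intro x
    by_cases hx : x ∈ near u r
    · have h1 := (f x).2
      have h2 := (stepFun u w x).2
      simp only [upperEnv, hx, if_true, Real.log_one, mul_zero, add_zero, Set.indicator_of_mem]
      nlinarith [(binEntropy_mem (f x)).2, h1.1, h1.2, h2.1, h2.2]
    · have h := mul_log_add_binEntropy_le (f x).2 (stepFun u w x).2 hr hr1
      simp only [upperEnv, hx, if_false, Set.indicator_of_notMem, not_false_eq_true, bern, if_true,
        Bool.false_eq_true]
      linarith
  have hI := (integrable_const (μ := (volume : Measure I)) (2 : ℝ)).indicator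
    (measurableSet_near u r)
  have hH := integrable_binEntropy hf
  have hS := (integrable_sq_sub hf (measurable_stepFun u w)).div_const 9
  have hn := measureReal_near_le u hr.le
  have hA : Integrable fun x => 2 * r + (near u r).indicator (fun _ => (2 : ℝ)) x :=
    (integrable_const (2 * r)).add hI
  have hB : Integrable fun x => 2 * r + (near u r).indicator (fun _ => (2 : ℝ)) x
      - Real.binEntropy (f x) := hA.sub hH
  calc meanLog f (upperEnv u w r) ≤ _ := integral_mono
        (integrable_meanLog hf (measurable_upperEnv u w r) hr (le_upperEnv u w hr1)
          (upperEnv_le u w hr1))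
        (hB.sub hS) hpt
    _ = 2 * r + volume.real (near u r) * 2 - entropy f
          - (∫ x, ((f x : ℝ) - stepFun u w x) ^ 2) / 9 := by
        rw [integral_sub' hB hS, integral_sub hA hH, integral_add (integrable_const (2 * r)) hI,
          integral_indicator_const _ (measurableSet_near u r), integral_div]
        simp [entropy]
    _ ≤ _ := by linarith

lemma IsDataStream.eventually_likelihood_le_of_ball (hXY : IsDataStream P f X Y)
    (hf : Measurable f) {m : ℕ} (θ : (Fin m → I) × (Fin (m + 1) → I)) {r : ℝ} (hr : 0 < r)
    (hr1 : r ≤ 1) {δ : ℝ}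
    (hδ : (2 + 4 * m) * r - (∫ x, ((f x : ℝ) - stepFun θ.1 θ.2 x) ^ 2) / 9 < δ) :
    ∀ᵐ ω ∂P, ∀ᶠ n : ℕ in atTop, ∀ η ∈ Metric.ball θ r,
      likelihood η.1 η.2 (sample X Y n ω) ≤ Real.exp (n * (-entropy f + δ)) := by
  have h := meanLog_upperEnv_le hf θ.1 θ.2 hr hr1
  filter_upwards [hXY.eventually_prod_le hf (measurable_upperEnv θ.1 θ.2 r) hr
    (le_upperEnv _ _ hr1) (upperEnv_le _ _ hr1) (κ := -entropy f + δ) (by linarith)] with ω hω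
  filter_upwards [hω] with n hn η hη
  rw [likelihood_eq_prod]
  refine le_trans (Finset.prod_le_prod (fun j _ => bern_nonneg _ _) fun j _ => ?_) hn
  rw [Metric.mem_ball, Prod.dist_eq, max_lt_iff] at hη
  exact bern_le_upperEnv hη.1 hη.2 _

lemma IsDataStream.eventually_likelihood_le (hXY : IsDataStream P f X Y) (hf : Measurable f)
    {m : ℕ} {T : Set ((Fin m → I) × (Fin (m + 1) → I))} {a δ : ℝ}
    (hT : ∀ θ ∈ T, a ≤ ∫ x, ((f x : ℝ) - stepFun θ.1 θ.2 x) ^ 2) (hδ : -(a / 9) < δ) :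
    ∀ᵐ ω ∂P, ∀ᶠ n : ℕ in atTop, ∀ θ ∈ T,
      likelihood θ.1 θ.2 (sample X Y n ω) ≤ Real.exp (n * (-entropy f + δ)) := by
  -- The radius is chosen so that the envelope error `(2 + 4m)r` uses at most half of the gap `δ +
  -- a/9`.
  have hr : 0 < min 1 ((δ + a / 9) / (2 * (2 + 4 * m))) :=
    lt_min one_pos (div_pos (by linarith) (by positivity))
  set r := min 1 ((δ + a / 9) / (2 * (2 + 4 * m))) with hr_def
  have hr2 : (2 + 4 * m) * r ≤ (δ + a / 9) / 2 := by
    calc (2 + 4 * m) * r ≤ (2 + 4 * m) * ((δ + a / 9) / (2 * (2 + 4 * m))) :=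
          mul_le_mul_of_nonneg_left (min_le_right _ _) (by positivity)
      _ = _ := by field_simp
  -- The centres must lie in `T`, since the lower bound `a` is only available there.
  obtain ⟨t, htT, ht, hcover⟩ := totallyBounded_iff_subset.1
    ((isCompact_univ (X := (Fin m → I) × (Fin (m + 1) → I))).totallyBounded.subset
      (Set.subset_univ T)) _ (Metric.dist_mem_uniformity hr)
  have h := (ae_ball_iff ht.countable).2 fun θ (hθ : θ ∈ t) =>
    hXY.eventually_likelihood_le_of_ball hf θ hr (min_le_left _ _) (δ := δ)
      (by linarith [hT θ (htT hθ)])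
  filter_upwards [h] with ω hω
  filter_upwards [(eventually_all_finite ht).2 hω] with n hn η hη
  obtain ⟨θ, hθ, hd⟩ := Set.mem_iUnion₂.1 (hcover hη)
  exact hn θ hθ η hd

lemma integral_sq_sub_pos (hf : Measurable f) {g : I → I} (hg : Measurable g)
    (hfg : ¬ f =ᵐ[volume] g) : 0 < ∫ x, ((f x : ℝ) - g x) ^ 2 := by
  refine lt_of_le_of_ne (integral_nonneg fun x => sq_nonneg _) fun h => hfg ?_
  have h0 := (integral_eq_zero_iff_of_nonneg (fun x => sq_nonneg _)
    (integrable_sq_sub hf hg)).1 h.symm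
  filter_upwards [h0] with x hx
  exact Subtype.ext (sub_eq_zero.1 (pow_eq_zero_iff two_ne_zero |>.1 hx))

/-- Integrate `t² ≥ 2εt - ε²` at `t = |g - f|`. -/
lemma sq_le_integral_sq_sub (hf : Measurable f) {g : I → I} (hg : Measurable g) {ε : ℝ}
    (hε : 0 ≤ ε) (h : ε ≤ l1dist g f) : ε ^ 2 ≤ ∫ x, ((f x : ℝ) - g x) ^ 2 := by
  have h1 : Integrable fun x : I => |(g x : ℝ) - f x| := by
    refine (integrable_of_measurable_of_bound (C := 1) (by fun_prop) fun x => ?_).abs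
    have h1 := (f x).2
    have h2 := (g x).2
    rw [abs_le]
    constructor <;> linarith [h1.1, h1.2, h2.1, h2.2]
  have h2 : ∫ x, (2 * ε * |(g x : ℝ) - f x| - ε ^ 2) ≤ ∫ x, ((f x : ℝ) - g x) ^ 2 := by
    refine integral_mono ((h1.const_mul _).sub (integrable_const _)) (integrable_sq_sub hf hg)
      fun x => ?_
    have := sq_nonneg (|(g x : ℝ) - f x| - ε)
    have h3 := sq_abs ((g x : ℝ) - f x)
    dsimp only
    nlinarith
  rw [integral_sub (h1.const_mul _) (integrable_const _), integral_const_mul] at h2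
  have h3 : ∫ x : I, |(g x : ℝ) - f x| = l1dist g f := rfl
  rw [h3] at h2
  simp at h2
  nlinarith

/-- Every parameter has a positive `L²` distance to `f`, hence a local exponent. Compact induction
merges these into one `δ`, so no minimal distance has to be exhibited. -/
lemma IsDataStream.exists_eventually_likelihood_le (hXY : IsDataStream P f X Y)
    (hf : Measurable f) {m : ℕ}
    (hne : ∀ (u : Fin m → I) (w : Fin (m + 1) → I), ¬ f =ᵐ[volume] stepFun u w) :
    ∃ δ : ℝ, 0 < δ ∧ ∀ᵐ ω ∂P, ∀ᶠ n : ℕ in atTop, ∀ (u : Fin m → I) (w : Fin (m + 1) → I),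
      likelihood u w (sample X Y n ω) ≤ Real.exp (n * (-entropy f + -δ)) := by
  suffices H : ∃ δ : ℝ, 0 < δ ∧ ∀ᵐ ω ∂P, ∀ᶠ n : ℕ in atTop,
      ∀ θ ∈ (Set.univ : Set ((Fin m → I) × (Fin (m + 1) → I))),
      likelihood θ.1 θ.2 (sample X Y n ω) ≤ Real.exp (n * (-entropy f + -δ)) by
    obtain ⟨δ, hδ, h⟩ := H
    refine ⟨δ, hδ, ?_⟩
    filter_upwards [h] with ω hω
    filter_upwards [hω] with n hn u w
    exact hn (u, w) trivial
  have hK : IsCompact (Set.univ : Set ((Fin m → I) × (Fin (m + 1) → I))) := isCompact_univ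
  refine hK.induction_on (p := fun S : Set ((Fin m → I) × (Fin (m + 1) → I)) =>
      ∃ δ : ℝ, 0 < δ ∧ ∀ᵐ ω ∂P, ∀ᶠ n : ℕ in atTop,
      ∀ θ ∈ S, likelihood θ.1 θ.2 (sample X Y n ω) ≤ Real.exp (n * (-entropy f + -δ)))
    ⟨1, one_pos, by simp⟩ ?_ ?_ ?_
  · rintro S T hST ⟨δ, hδ, h⟩
    refine ⟨δ, hδ, ?_⟩
    filter_upwards [h] with ω hω
    filter_upwards [hω] with n hn θ hθ
    exact hn θ (hST hθ)
  · rintro S T ⟨δ, hδ, h⟩ ⟨δ', hδ', h'⟩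
    refine ⟨min δ δ', lt_min hδ hδ', ?_⟩
    filter_upwards [h, h'] with ω hω hω'
    filter_upwards [hω, hω'] with n hn hn' θ hθ
    rcases hθ with hθ | hθ
    · refine (hn θ hθ).trans ?_
      gcongr
      exact min_le_left _ _
    · refine (hn' θ hθ).trans ?_
      gcongr
      exact min_le_right _ _
  · intro θ _
    have ha := integral_sq_sub_pos hf (measurable_stepFun θ.1 θ.2) (hne θ.1 θ.2)
    set a := ∫ x, ((f x : ℝ) - stepFun θ.1 θ.2 x) ^ 2
    -- The envelope error is at most `a/36`, and `a/36 - a/9 = -a/12 < -a/18`.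
    have hr : 0 < min 1 (a / 36 / (2 + 4 * m)) := lt_min one_pos (by positivity)
    have hr2 : (2 + 4 * m) * min 1 (a / 36 / (2 + 4 * m)) ≤ a / 36 := by
      calc _ ≤ (2 + 4 * m) * (a / 36 / (2 + 4 * m)) :=
            mul_le_mul_of_nonneg_left (min_le_right _ _) (by positivity)
        _ = _ := by field_simp
    exact ⟨Metric.ball θ (min 1 (a / 36 / (2 + 4 * m))),
      mem_nhdsWithin_of_mem_nhds (Metric.ball_mem_nhds θ hr), a / 18, by positivity,
      hXY.eventually_likelihood_le_of_ball hf θ hr (min_le_left _ _) (by linarith)⟩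

/-! ### Lower bounds for the predictive probability -/

instance isOpenPosMeasure_volume_unitInterval : (volume : Measure I).IsOpenPosMeasure := by
  refine ⟨fun U hU hne h0 => ?_⟩
  obtain ⟨V, hV, rfl⟩ := isOpen_induced_iff.1 hU
  obtain ⟨x, hx⟩ := hne
  have hcl : (x : ℝ) ∈ closure (Set.Ioo (0 : ℝ) 1) := by
    rw [closure_Ioo zero_ne_one]
    exact x.2
  have hne : (V ∩ Set.Ioo (0 : ℝ) 1).Nonempty := mem_closure_iff.1 hcl V hV hx
  rw [unitInterval.volume_apply] at h0
  refine ((hV.inter isOpen_Ioo).measure_pos volume hne).ne' (measure_mono_null ?_ h0)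
  rintro y ⟨hyV, hy⟩
  exact ⟨⟨y, hy.1.le, hy.2.le⟩, hyV, rfl⟩

/-- The heights `w`, moved towards `1/2` by the contraction with ratio `1 - 2r`. -/
def shrink {m : ℕ} (w : Fin (m + 1) → I) (r : ℝ) (hr : 0 < r) (hr1 : r < 1 / 2) :
    Fin (m + 1) → I := fun i => ⟨(1 - 2 * r) * w i + r, by
      have h := (w i).2
      constructor <;> nlinarith [h.1, h.2]⟩

open Classical in
/-- A lower bound for the likelihood of one observation under all step functions whose split points
are `s`-close to `u` and whose heights are `r/2`-close to the shrunk heights. -/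
def lowerEnv {m : ℕ} (u : Fin m → I) (w : Fin (m + 1) → I) (r s : ℝ) (p : I × Bool) : ℝ :=
  if p.1 ∈ near u s then r / 2 else (1 - 2 * r) * bern (stepFun u w p.1) p.2 + r / 2

lemma measurable_lowerEnv {m : ℕ} (u : Fin m → I) (w : Fin (m + 1) → I) (r s : ℝ) :
    Measurable (lowerEnv u w r s) :=
  Measurable.ite (measurable_fst (measurableSet_near u s)) measurable_const
    (((measurable_bern_comp (measurable_stepFun u w)).const_mul _).add_const _)

lemma le_lowerEnv {m : ℕ} (u : Fin m → I) (w : Fin (m + 1) → I) {r : ℝ} (hr1 : r < 1 / 2) (s : ℝ)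
    (p : I × Bool) : r / 2 ≤ lowerEnv u w r s p := by
  unfold lowerEnv
  split_ifs
  · exact le_rfl
  · nlinarith [bern_nonneg (stepFun u w p.1) p.2]

lemma lowerEnv_le {m : ℕ} (u : Fin m → I) (w : Fin (m + 1) → I) {r : ℝ} (hr : 0 < r)
    (hr1 : r < 1 / 2) (s : ℝ) (p : I × Bool) : lowerEnv u w r s p ≤ 1 := by
  unfold lowerEnv
  split_ifs
  · linarith
  · nlinarith [bern_le_one (stepFun u w p.1) p.2]

lemma bern_stepFun_shrink {m : ℕ} (u : Fin m → I) (w : Fin (m + 1) → I) {r : ℝ} (hr : 0 < r)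
    (hr1 : r < 1 / 2) (x : I) (b : Bool) :
    bern (stepFun u (shrink w r hr hr1) x) b = (1 - 2 * r) * bern (stepFun u w x) b + r := by
  cases b
  · simp only [bern, stepFun, shrink, Bool.false_eq_true, if_false]
    ring
  · simp [bern, stepFun, shrink]

/-- Shrinking gives both outcomes probability at least `r` in every cell. So even where moving the
split points changes the cell, at least `r / 2` survives the perturbation of the heights. -/
lemma lowerEnv_le_bern {m : ℕ} {u v : Fin m → I} {w z : Fin (m + 1) → I} {r s : ℝ} (hr : 0 < r)
    (hr1 : r < 1 / 2) (huv : dist v u < s) (hwz : dist z (shrink w r hr hr1) < r / 2)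
    (p : I × Bool) : lowerEnv u w r s p ≤ bern (stepFun v z p.1) p.2 := by
  unfold lowerEnv
  split_ifs with h
  · have h1 : |bern (stepFun v z p.1) p.2 - bern (stepFun v (shrink w r hr hr1) p.1) p.2|
        < r / 2 := by
      rw [abs_bern_sub]
      exact (dist_le_pi_dist z _ _).trans_lt hwz
    rw [bern_stepFun_shrink] at h1
    nlinarith [(abs_lt.1 h1).1, bern_nonneg (stepFun v w p.1) p.2]
  · have h1 := abs_bern_stepFun_sub_lt huv hwz h p.2
    rw [bern_stepFun_shrink] at h1
    linarith [(abs_lt.1 h1).1]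

/-- The radius `s` for split points is kept separate from `r`: the cost `log (r / 2)` near them is
large for small `r`, and is offset by choosing `s` afterwards. -/
lemma le_meanLog_lowerEnv (hf : Measurable f) {m : ℕ} {u : Fin m → I} {w : Fin (m + 1) → I}
    (hfu : f =ᵐ[volume] stepFun u w) {r s : ℝ} (hr : 0 < r) (hr1 : r < 1 / 2) (hs : 0 ≤ s) :
    -entropy f + (Real.log (1 - 2 * r) + 2 * m * s * Real.log (r / 2))
      ≤ meanLog f (lowerEnv u w r s) := by
  have hl : Real.log (r / 2) ≤ 0 := Real.log_nonpos (by linarith) (by linarith)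
  have hl2 : Real.log (1 - 2 * r) ≤ 0 := Real.log_nonpos (by linarith) (by linarith)
  have hI := (integrable_const (μ := (volume : Measure I)) (Real.log (r / 2))).indicator
    (measurableSet_near u s)
  have hH := integrable_binEntropy hf
  have hA : Integrable fun x =>
      Real.log (1 - 2 * r) + (near u s).indicator (fun _ => Real.log (r / 2)) x :=
    (integrable_const _).add hI
  have hn := mul_le_mul_of_nonpos_right (measureReal_near_le u hs) hl
  calc _ ≤ Real.log (1 - 2 * r) + volume.real (near u s) * Real.log (r / 2) - entropy f := by
        linarith
    _ = ∫ x, (Real.log (1 - 2 * r) + (near u s).indicator (fun _ => Real.log (r / 2)) x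
          - Real.binEntropy (f x)) := by
        rw [integral_sub hA hH, integral_add (integrable_const _) hI,
          integral_indicator_const _ (measurableSet_near u s)]
        simp [entropy]
    _ ≤ meanLog f (lowerEnv u w r s) := by
        refine integral_mono_ae (hA.sub hH) (integrable_meanLog hf (measurable_lowerEnv u w r s)
          (half_pos hr) (le_lowerEnv u w hr1 s) (lowerEnv_le u w hr hr1 s)) ?_
        filter_upwards [hfu] with x hx
        by_cases hxn : x ∈ near u s
        · simp only [lowerEnv, hxn, if_true, Set.indicator_of_mem]
          linarith [(binEntropy_mem (f x)).1]
        · have h := le_mul_log_add_binEntropy (f x).2 hr hr1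
          simp only [lowerEnv, hxn, if_false, Set.indicator_of_notMem, not_false_eq_true, bern,
            if_true, Bool.false_eq_true, ← hx]
          linarith

lemma IsDataStream.eventually_le_Z (hXY : IsDataStream P f X Y) (hf : Measurable f) {m : ℕ}
    {u : Fin m → I} {w : Fin (m + 1) → I} (hfu : f =ᵐ[volume] stepFun u w) {δ : ℝ} (hδ : 0 < δ) :
    ∀ᵐ ω ∂P, ∀ᶠ n : ℕ in atTop,
      Real.exp (n * (-entropy f + -δ)) ≤ Z m (sample X Y n ω) := by
  have he : Real.exp (-(δ / 8)) < 1 := by simpa using hδ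
  -- Solves `log (1 - 2r) = -δ/8`.
  obtain ⟨r, hr_def⟩ : ∃ r, r = (1 - Real.exp (-(δ / 8))) / 2 := ⟨_, rfl⟩
  have hr : 0 < r := by linarith
  have hr1 : r < 1 / 2 := by linarith [Real.exp_pos (-(δ / 8))]
  have hlog : Real.log (1 - 2 * r) = -(δ / 8) := by
    rw [hr_def, show 1 - 2 * ((1 - Real.exp (-(δ / 8))) / 2) = Real.exp (-(δ / 8)) by ring,
      Real.log_exp]
  -- Makes the loss near the split points at most `δ/8`; the `+ 1` keeps the denominator positive
  -- when `m = 0`.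
  obtain ⟨s, hs_def⟩ : ∃ s, s = δ / 8 / (2 * m * |Real.log (r / 2)| + 1) := ⟨_, rfl⟩
  have hs : 0 < s := by rw [hs_def]; positivity
  have hs2 : -(δ / 8) ≤ 2 * m * s * Real.log (r / 2) := by
    have h1 : s * (2 * m * |Real.log (r / 2)| + 1) = δ / 8 := by
      rw [hs_def]
      field_simp
    have h2 : 2 * m * s * -|Real.log (r / 2)| ≤ 2 * m * s * Real.log (r / 2) :=
      mul_le_mul_of_nonneg_left (neg_abs_le _) (by positivity)
    linarith
  have hmean := le_meanLog_lowerEnv hf hfu hr hr1 hs.le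
  let S : Set ((Fin m → I) × (Fin (m + 1) → I)) :=
    Metric.ball u s ×ˢ Metric.ball (shrink w r hr hr1) (r / 2)
  have hSo : IsOpen S := Metric.isOpen_ball.prod Metric.isOpen_ball
  have hS : 0 < volume.real S := by
    have hpi : ∀ k : ℕ, (volume : Measure (Fin k → I)).IsOpenPosMeasure := fun k =>
      inferInstanceAs (Measure.pi fun _ => volume).IsOpenPosMeasure
    have : (volume : Measure ((Fin m → I) × (Fin (m + 1) → I))).IsOpenPosMeasure :=
      inferInstanceAs (volume.prod volume).IsOpenPosMeasure
    refine ENNReal.toReal_pos (hSo.measure_pos volume ⟨(u, shrink w r hr hr1), ?_⟩).ne'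
      (measure_ne_top _ _)
    exact ⟨Metric.mem_ball_self hs, Metric.mem_ball_self (half_pos hr)⟩
  -- The fixed volume of `S` is eventually larger than `exp(-nδ/2)`, so it costs only the second
  -- half of `δ`.
  have hlim : Tendsto (fun n : ℕ => Real.exp (-(n * (δ / 2)))) atTop (𝓝 0) :=
    Real.tendsto_exp_neg_atTop_nhds_zero.comp
      (tendsto_natCast_atTop_atTop.atTop_mul_const (half_pos hδ))
  filter_upwards [hXY.eventually_le_prod hf (measurable_lowerEnv u w r s) (half_pos hr)
    (le_lowerEnv u w hr1 s) (lowerEnv_le u w hr hr1 s) (κ := -entropy f + -(δ / 2))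
    (by linarith)] with ω hω
  filter_upwards [hω, hlim.eventually_lt_const hS] with n hn hn2
  refine le_trans ?_ (measureReal_mul_le_Z (M := Real.exp (n * (-entropy f + -(δ / 2))))
    hSo.measurableSet fun θ hθ => ?_)
  · calc Real.exp (n * (-entropy f + -δ))
        = Real.exp (-(n * (δ / 2))) * Real.exp (n * (-entropy f + -(δ / 2))) := by
          rw [← Real.exp_add]
          congr 1
          ring
      _ ≤ _ := mul_le_mul_of_nonneg_right hn2.le (Real.exp_pos _).le
  · rw [likelihood_eq_prod]
    refine hn.trans (Finset.prod_le_prod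
      (fun j _ => (half_pos hr).le.trans (le_lowerEnv u w hr1 s _)) fun j _ => ?_)
    exact lowerEnv_le_bern hr hr1 hθ.1 hθ.2 _

/-- Events which almost surely occur eventually have probability tending to `1`. -/
lemma tendsto_measure_of_ae_eventually {E : ℕ → Set Ω} (h : ∀ᵐ ω ∂P, ∀ᶠ n in atTop, ω ∈ E n) :
    Tendsto (fun n => P (E n)) atTop (𝓝 1) := by
  let F : ℕ → Set Ω := fun n => ⋂ k ≥ n, E k
  have hF : Monotone F := fun a b hab => Set.biInter_subset_biInter_left fun k hk => hab.trans hk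
  have hU : P (⋃ n, F n) = 1 := by
    rw [← measure_univ (μ := P)]
    refine measure_congr (eventuallyEq_univ.2 ?_)
    filter_upwards [h] with ω hω
    obtain ⟨N, hN⟩ := eventually_atTop.1 hω
    exact Set.mem_iUnion.2 ⟨N, Set.mem_iInter₂.2 hN⟩
  have ht := tendsto_measure_iUnion_atTop (μ := P) hF
  rw [hU] at ht
  refine tendsto_of_tendsto_of_tendsto_of_le_of_le ht tendsto_const_nhds
    (fun n => measure_mono fun ω hω => ?_) fun n => prob_le_one
  exact Set.mem_iInter₂.1 hω n le_rfl

end BinReg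

end

/-! ### Deduction of (a) and (b) from the likelihood bounds -/

theorem corollary5 {Ω : Type*} [MeasurableSpace Ω] (P : Measure Ω) [IsProbabilityMeasure P]
    (f : I → I) (hf : Measurable f) (X : ℕ → Ω → I) (Y : ℕ → Ω → Bool)
    (hXY : BinReg.IsDataStream P f X Y) :
    (∀ k : ℕ, BinReg.IsStepFunction k f → ∀ m : ℕ, k ≤ m → ∀ ε : ℝ, 0 < ε →
      Tendsto (fun n : ℕ => P {ω |
          BinReg.posterior m (BinReg.sample X Y n ω) {g | ε ≤ BinReg.l1dist g f}
            < ENNReal.ofReal ε ∧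
          |(n : ℝ)⁻¹ * Real.log (BinReg.Z m (BinReg.sample X Y n ω)) + BinReg.entropy f| < ε})
        atTop (𝓝 1)) ∧
    (∀ K : ℕ, ¬ BinReg.IsStepFunction K f → ∃ ε : ℝ, 0 < ε ∧
      Tendsto (fun n : ℕ => P {ω | ∀ m : ℕ, m ≤ K →
          BinReg.Z m (BinReg.sample X Y n ω)
            < Real.exp (-(n : ℝ) * BinReg.entropy f - (n : ℝ) * ε)})
        atTop (𝓝 1)) := by
  constructor
  · intro k hk m hkm ε hε
    apply BinReg.tendsto_measure_of_ae_eventually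
    obtain ⟨u₀, w₀, -, h₀⟩ := hk
    obtain ⟨u, w, -, hfu⟩ := BinReg.isStepFunction_of_ae_eq hkm u₀ w₀ h₀
    have hlim : Tendsto (fun n : ℕ => Real.exp (-(n * (ε ^ 2 / 36)))) atTop (𝓝 0) :=
      Real.tendsto_exp_neg_atTop_nhds_zero.comp
        (tendsto_natCast_atTop_atTop.atTop_mul_const (by positivity))
    -- Off the `L¹` ball the likelihood has excess exponent `ε²/18 < ε²/9`; with `ε²/36` lost in
    -- `Z`, the posterior mass is at most `exp(-nε²/36)`. The bounds with `ε/2` give the entropy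
    -- limit.
    filter_upwards [hXY.eventually_le_Z hf hfu (δ := ε ^ 2 / 36) (by positivity),
      hXY.eventually_le_Z hf hfu (half_pos hε),
      hXY.eventually_likelihood_le hf (m := m) (T := Set.univ) (a := 0) (δ := ε / 2)
        (fun θ _ => integral_nonneg fun x => sq_nonneg _) (by linarith),
      hXY.eventually_likelihood_le hf (m := m)
        (T := {θ | ε ≤ BinReg.l1dist (BinReg.stepFun θ.1 θ.2) f}) (a := ε ^ 2)
        (δ := -(ε ^ 2 / 18))
        (fun θ hθ => BinReg.sq_le_integral_sq_sub hf (BinReg.measurable_stepFun _ _) hε.le hθ)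
        (by nlinarith)] with ω h1 h2 h3 h4
    filter_upwards [h1, h2, h3, h4, hlim.eventually_lt_const hε, eventually_gt_atTop 0]
      with n h1 h2 h3 h4 h5 hn
    have hn' : (0 : ℝ) < n := by exact_mod_cast hn
    have hZ : 0 < BinReg.Z m (BinReg.sample X Y n ω) := (Real.exp_pos _).trans_le h1
    constructor
    · refine (BinReg.posterior_le fun u w huw => h4 (u, w) huw).trans_lt ?_
      rw [← ENNReal.ofReal_div_of_pos hZ]
      refine (ENNReal.ofReal_lt_ofReal_iff hε).2 (lt_of_le_of_lt ?_ h5)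
      rw [div_le_iff₀ hZ]
      calc Real.exp (n * (-BinReg.entropy f + -(ε ^ 2 / 18)))
          = Real.exp (-(n * (ε ^ 2 / 36))) *
              Real.exp (n * (-BinReg.entropy f + -(ε ^ 2 / 36))) := by
            rw [← Real.exp_add]
            congr 1
            ring
        _ ≤ _ := mul_le_mul_of_nonneg_left h1 (Real.exp_pos _).le
    · have h6 := BinReg.Z_le fun u w => h3 (u, w) trivial
      rw [← Real.log_le_iff_le_exp hZ] at h6
      rw [← Real.le_log_iff_exp_le hZ] at h2
      have h7 := mul_le_mul_of_nonneg_left h6 (inv_pos.2 hn').le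
      have h8 := mul_le_mul_of_nonneg_left h2 (inv_pos.2 hn').le
      rw [inv_mul_cancel_left₀ hn'.ne'] at h7 h8
      rw [abs_lt]
      constructor <;> linarith
  · intro K hK
    have h := fun m : Fin (K + 1) => hXY.exists_eventually_likelihood_le hf (m := m)
      fun u w hfu => hK (BinReg.isStepFunction_of_ae_eq (Nat.lt_succ_iff.1 m.2) u w hfu)
    choose δ hδ h using h
    obtain ⟨m₀, hm₀⟩ := Finite.exists_min δ
    -- Halving the smallest exponent makes the inequality strict for `n > 0`.
    refine ⟨δ m₀ / 2, half_pos (hδ m₀), BinReg.tendsto_measure_of_ae_eventually ?_⟩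
    filter_upwards [ae_all_iff.2 h] with ω hω
    filter_upwards [eventually_all.2 hω, eventually_gt_atTop 0] with n h hn m hm
    have hn' : (0 : ℝ) < n := by exact_mod_cast hn
    refine (BinReg.Z_le (h ⟨m, Nat.lt_succ_of_le hm⟩)).trans_lt (Real.exp_lt_exp.2 ?_)
    have h1 := mul_le_mul_of_nonneg_left (hm₀ ⟨m, Nat.lt_succ_of_le hm⟩) hn'.le
    have h2 := mul_pos hn' (hδ m₀)
    linarith
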